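/- **Setting.** Let $\Omega\subseteq\mathbb R^{\mathsf d}$ be open and bounded and let $E(\mu)=\sum_i f_i(\mu)E_i$, $A(\mu)=\sum_i g_i(\mu)A_i$, $B(\mu)=\sum_i h_i(\mu)B_i$, $C(\mu)=\sum_i k_i(\mu)C_i$ (finite sums) with real matrices $E_i,A_i\in\mathbb R^{\mathsf n\times \mathsf n}$, $B_i\in\mathbb R^{\mathsf n\times \mathsf m}$, $C_i\in\mathbb R^{\mathsf p\times \mathsf n}$ and real-analytic functions $f_i,g_i,h_i,k_i:\Omega\to\mathbb R$. Put $D(\mu,s)=sE(\mu)-A(\mu)$ and $H[\mu](s)=C(\mu)D(\mu,s)^{-1}B(\mu)$. For $\omega\in\mathbb R\cup\{\infty\}$ let $\sigma(\mu,\omega)$ be the largest singular value of the rational function $H[\mu]$ at $\mathrm i\omega$ (as a limit at $\omega=\infty$ and where $D(\mu,\mathrm i\omega)$ is singular). For $V,W\in\mathbb C^{\mathsf n\times r}$ with orthonormal columns, $D^{V,W}$, $H^{V,W}$ and $\sigma^{V,W}$ denote the same objects for the reduced system, in which $E_i,A_i,B_i,C_i$ are replaced by $W^*E_iV,\,W^*A_iV,\,W^*B_i,\,C_iV$.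 $\sigma_{\min}$ denotes the smallest singular value. Let $\underline\Omega\subset\Omega$ be compact such that, for every $\mu\in\underline\Omega$, $H[\mu]$ is well-defined (regular pencil) and belongs to $\mathcal H_\infty$, and let $\mu_*\in\underline\Omega$ be a local or global minimizer over $\underline\Omega$ of $\mu\mapsto\|H[\mu]\|_{\mathcal H_\infty}=\sup_{\operatorname{Re}s>0}\|H[\mu](s)\|_2$. **Algorithm.** From initial subspaces $\mathcal V_0,\mathcal W_0\subseteq\mathbb C^{\mathsf n}$ of equal dimension, iteration $j=1,2,\dots$ of the *basic algorithm* chooses $\mu^{(j)}$ as a minimizer over $\underline\Omega$ of the norm $\sup_{\omega\in\mathbb R}\sigma^{\mathcal V_{j-1},\mathcal W_{j-1}}(\mu,\omega)$ of the reduced system (taken as $+\infty$ where the reduced pencil is not regular), then a maximizer $\omega^{(j)}\in\mathbb R$ of $\sigma(\mu^{(j)},\cdot)$ at which $D(\mu^{(j)},\mathrm i\omega^{(j)})$ is invertible, and sets $\mathcal V_j=\mathcal V_{j-1}+\mathrm{Col}(\widetilde V_j)$, $\mathcal W_j=\mathcal W_{j-1}+\mathrm{Col}(\widetilde W_j)$,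 where, with $D,B,C,H$ evaluated at $(\mu^{(j)},\mathrm i\omega^{(j)})$, $\widetilde V_j=D^{-1}B$ if $\mathsf m\le\mathsf p$ and $\widetilde V_j=D^{-1}BH^*$ if $\mathsf m>\mathsf p$, and $\widetilde W_j=D^{-*}C^*$ if $\mathsf m\ge\mathsf p$ and $\widetilde W_j=D^{-*}C^*H$ if $\mathsf m<\mathsf p$. The *extended algorithm* in addition enlarges the spaces for $j\ge2$ in the same way at the points $\mu^{(j,aq)}=\mu^{(j)}+\|\mu^{(j)}-\mu^{(j-1)}\|_2\,e_{aq}\in\Omega$, $1\le a\le q\le\mathsf d$, with maximizers $\omega^{(j,aq)}$ of $\sigma(\mu^{(j,aq)},\cdot)$, where $e_{aa}=e_a$ and $e_{aq}=(e_a+e_q)/\sqrt2$ for $a\ne q$. The spaces $\mathcal V_j,\mathcal W_j$ are supposed to have the same dimension; $V_j,W_j$ have orthonormal columns spanning them. **Assumptions.** Let $\omega_*\in\mathbb R$ be such that (i) the supremum of $\sigma(\mu_*,\cdot)$ over $\mathbb R\cup\{\infty\}$ is attained at $\omega_*$ and, up to the sign of the frequency (the data being real, $\sigma(\mu,-\omega)=\sigma(\mu,\omega)$),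 only there; (ii) $\sigma(\mu_*,\omega_*)>0$ is a simple singular value of $H[\mu_*](\mathrm i\omega_*)$; and (iii) $\sigma$, as a function on $\underline\Omega\times(\mathbb R\cup\{\infty\})$, is continuous at the points of $\{\mu_*\}\times(\mathbb R\cup\{\infty\})$. Let $\beta>0$ with $\sigma_{\min}(D(\mu_*,\mathrm i\omega_*))\ge\beta$, and let $k\ge1$. **Lemma 3.3.** There exist $U$ and $\eta_\mu,\eta_\omega>0$, with $\overline{\mathcal B}(\mu_*,\eta_\mu)\subseteq\Omega$, such that the following holds for every family $R$ of runs ($k$ iterations) of the basic or the extended algorithm for which $\omega_*\omega^{(k)}\ge0$ and for which $\mu^{(k)}\to\mu_*$ as $\mu^{(1)}\to\mu_*$. If $\|\mu^{(1)}-\mu_*\|_2$ is small enough, then every run in $R$ with $$\sigma_{\min}\big(D^{V_k,W_k}(\mu_*,\mathrm i\omega_*)\big)\ge\beta$$ satisfies, for all $\mu\in\overline{\mathcal B}(\mu_*,\eta_\mu)$ and all $\omega\in\overline{\mathcal B}(\omega_*,\eta_\omega)$: $D^{V_k,W_k}(\mu,\mathrm i\omega)$ is nonsingular, $\sigma^{\mathcal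 V_k,\mathcal W_k}$ is three times continuously differentiable at $(\mu,\omega)$, and $$\big|\sigma^{\mathcal V_k,\mathcal W_k}_{\chi_1}(\mu,\omega)\big|\le U,\qquad \big|\sigma^{\mathcal V_k,\mathcal W_k}_{\chi_1\chi_2}(\mu,\omega)\big|\le U,\qquad \big|\sigma^{\mathcal V_k,\mathcal W_k}_{\chi_1\chi_2\chi_3}(\mu,\omega)\big|\le U$$ for all $\chi_1,\chi_2,\chi_3\in\{\omega\}\cup\{\mu_j\mid j=1,\dots,\mathsf d\}$. In particular $U,\eta_\mu,\eta_\omega$ do not depend on $\mu^{(1)}$ (nor on the initial subspaces). -/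

import Mathlib

open Filter Topology Matrix
open scoped OnePoint

noncomputable section

/-- The parameter space `ℝ^d` with the Euclidean norm. -/
abbrev Param (d : ℕ) : Type := EuclideanSpace ℝ (Fin d)

/-- The singular values of a complex matrix in descending order, with multiplicity, numbered from
`0` (and continued by zeros). -/
def singVal {a b : ℕ} (M : Matrix (Fin a) (Fin b) ℂ) (i : ℕ) : ℝ :=
  (Matrix.toEuclideanLin M).singularValues i

/-- The smallest singular value of a square matrix (it is `0` for the matrix of size `0`). -/
def sigmaMin {r : ℕ} (M : Matrix (Fin r) (Fin r) ℂ) : ℝ :=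
  singVal M (r - 1)

/-- The column space of a matrix. -/
def colSpace {a b : ℕ} (M : Matrix (Fin a) (Fin b) ℂ) : Submodule ℂ (Fin a → ℂ) :=
  LinearMap.range M.mulVecLin

/-- A (full or reduced) parameter-dependent descriptor system of order `r` with `m` inputs and
`p` outputs, given by its coefficient functions. -/
structure StateSpace (d r m p : ℕ) where
  E : Param d → Matrix (Fin r) (Fin r) ℂ
  A : Param d → Matrix (Fin r) (Fin r) ℂ
  B : Param d → Matrix (Fin r) (Fin m) ℂ
  C : Param d → Matrix (Fin p) (Fin r) ℂ

namespace StateSpace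

variable {d r m p : ℕ} (G : StateSpace d r m p)

/-- `D(μ, s) = s E(μ) - A(μ)`. -/
def D (μ : Param d) (s : ℂ) : Matrix (Fin r) (Fin r) ℂ := s • G.E μ - G.A μ

/-- The pencil `s ↦ D(μ, s)` is regular. -/
def Regular (μ : Param d) : Prop := ∃ s : ℂ, (G.D μ s).det ≠ 0

/-- The transfer function `H[μ](s) = C(μ) D(μ, s)⁻¹ B(μ)`, where `D(μ, s)` is nonsingular. -/
def H (μ : Param d) (s : ℂ) : Matrix (Fin p) (Fin m) ℂ := G.C μ * (G.D μ s)⁻¹ * G.B μ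

/-- `D(μ, iω)`. -/
def Di (μ : Param d) (ω : ℝ) : Matrix (Fin r) (Fin r) ℂ := G.D μ (Complex.I * ω)

/-- `H[μ](iω)`. -/
def Hi (μ : Param d) (ω : ℝ) : Matrix (Fin p) (Fin m) ℂ := G.H μ (Complex.I * ω)

/-- `σ(μ, ω)`, the largest singular value of `H[μ](iω)`. -/
def sigma (μ : Param d) (ω : ℝ) : ℝ := singVal (G.Hi μ ω) 0

/-- `σ(μ, ω)` for all frequencies `ω ∈ ℝ ∪ {∞}` of the rational function `H[μ]`: the value at `∞`
and at the (finitely many) frequencies at which `D(μ, iω)` is singular is the limit. Where `D(μ, iω)`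
is nonsingular this is `G.sigma μ ω`. -/
def sigmaExt (μ : Param d) : OnePoint ℝ → ℝ
  | ∞ => limUnder (cocompact ℝ) (G.sigma μ)
  | (ω : ℝ) => limUnder (𝓝[≠] ω) (G.sigma μ)

/-- The `H_∞`-norm `sup_{Re s > 0} ‖H[μ](s)‖₂` of a system with a regular pencil. The finitely many
points at which `D(μ, s)` is singular may be left out, since `H[μ]` is rational. -/
def hinfNorm (μ : Param d) : ENNReal :=
  ⨆ (s : ℂ) (_ : 0 < s.re) (_ : (G.D μ s).det ≠ 0), ENNReal.ofReal (singVal (G.H μ s) 0)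

/-- `H[μ]` is well-defined and belongs to `H_∞`. -/
def MemHinf (μ : Param d) : Prop := G.Regular μ ∧ G.hinfNorm μ < ⊤

open Classical in
/-- The `L_∞`-norm `sup_ω σ(μ, ω)`, with the value `∞` if `H[μ]` is not defined. The finitely many
frequencies at which `D(μ, iω)` is singular may be left out, since `H[μ]` is rational. -/
def linfNorm (μ : Param d) : ENNReal :=
  if G.Regular μ then ⨆ (ω : ℝ) (_ : (G.Di μ ω).det ≠ 0), ENNReal.ofReal (G.sigma μ ω) else ⊤

/-- `ω` is a maximizer of `σ(μ, ·)` at which `D(μ, iω)` can be inverted. -/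
def IsMaxFreq (μ : Param d) (ω : ℝ) : Prop :=
  (G.Di μ ω).det ≠ 0 ∧ ∀ ω' : ℝ, (G.Di μ ω').det ≠ 0 → G.sigma μ ω' ≤ G.sigma μ ω

/-- The subspace by which the right projection space is enlarged for the pair `(μ, ω)`. -/
def expandV (μ : Param d) (ω : ℝ) : Submodule ℂ (Fin r → ℂ) :=
  if m ≤ p then colSpace ((G.Di μ ω)⁻¹ * G.B μ)
  else colSpace ((G.Di μ ω)⁻¹ * G.B μ * (G.Hi μ ω)ᴴ)

/-- The subspace by which the left projection space is enlarged for the pair `(μ, ω)`. -/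
def expandW (μ : Param d) (ω : ℝ) : Submodule ℂ (Fin r → ℂ) :=
  if p ≤ m then colSpace (((G.Di μ ω)⁻¹)ᴴ * (G.C μ)ᴴ)
  else colSpace (((G.Di μ ω)⁻¹)ᴴ * (G.C μ)ᴴ * G.Hi μ ω)

/-- The smoothness assumption at `(μ₀, ω₀)`: the supremum of `σ(μ₀, ·)` over `ℝ ∪ {∞}` is attained at
`ω₀` and, up to the sign of the frequency, only there; and `σ(μ₀, ω₀)` is positive and a simple
singular value of `H[μ₀](iω₀)`. -/
def Smooth (μ₀ : Param d) (ω₀ : ℝ) : Prop :=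
  (∀ ω : OnePoint ℝ, ω ≠ ((ω₀ : ℝ) : OnePoint ℝ) → ω ≠ ((-ω₀ : ℝ) : OnePoint ℝ) →
    G.sigmaExt μ₀ ω < G.sigma μ₀ ω₀) ∧
  0 < singVal (G.Hi μ₀ ω₀) 0 ∧ singVal (G.Hi μ₀ ω₀) 1 < singVal (G.Hi μ₀ ω₀) 0

end StateSpace

/-- The data of the problem: an open and bounded parameter set `Ω`, real matrices, and scalar
functions that are real-analytic on `Ω`. -/
structure ParamSystem (d n m p : ℕ) where
  Ω : Set (Param d)
  isOpen : IsOpen Ω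
  isBounded : Bornology.IsBounded Ω
  κE : ℕ
  κA : ℕ
  κB : ℕ
  κC : ℕ
  E : Fin κE → Matrix (Fin n) (Fin n) ℝ
  A : Fin κA → Matrix (Fin n) (Fin n) ℝ
  B : Fin κB → Matrix (Fin n) (Fin m) ℝ
  C : Fin κC → Matrix (Fin p) (Fin n) ℝ
  f : Fin κE → Param d → ℝ
  g : Fin κA → Param d → ℝ
  h : Fin κB → Param d → ℝ
  k : Fin κC → Param d → ℝ
  analytic_f : ∀ i, AnalyticOnNhd ℝ (f i) Ω
  analytic_g : ∀ i, AnalyticOnNhd ℝ (g i) Ω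
  analytic_h : ∀ i, AnalyticOnNhd ℝ (h i) Ω
  analytic_k : ∀ i, AnalyticOnNhd ℝ (k i) Ω

/-- A real matrix as a complex matrix. -/
def toC {a b : ℕ} (M : Matrix (Fin a) (Fin b) ℝ) : Matrix (Fin a) (Fin b) ℂ :=
  M.map (fun x : ℝ => (x : ℂ))

namespace ParamSystem

variable {d n m p : ℕ} (S : ParamSystem d n m p)

/-- The full system. -/
def full : StateSpace d n m p where
  E μ := ∑ i, (S.f i μ : ℂ) • toC (S.E i)
  A μ := ∑ i, (S.g i μ : ℂ) • toC (S.A i)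
  B μ := ∑ i, (S.h i μ : ℂ) • toC (S.B i)
  C μ := ∑ i, (S.k i μ : ℂ) • toC (S.C i)

/-- The system reduced by the matrices `V` and `W`. -/
def reduced {r : ℕ} (V W : Matrix (Fin n) (Fin r) ℂ) : StateSpace d r m p where
  E μ := ∑ i, (S.f i μ : ℂ) • (Wᴴ * toC (S.E i) * V)
  A μ := ∑ i, (S.g i μ : ℂ) • (Wᴴ * toC (S.A i) * V)
  B μ := ∑ i, (S.h i μ : ℂ) • (Wᴴ * toC (S.B i))
  C μ := ∑ i, (S.k i μ : ℂ) • (toC (S.C i) * V)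

end ParamSystem

/-- The quantities produced by the subspace algorithms: the parameters `μ⁽ʲ⁾` and the frequencies
`ω⁽ʲ⁾` (`j ≥ 1`), and the matrices `V_j`, `W_j` (`j ≥ 0`) whose columns are bases of the projection
spaces. The spaces `𝒱_j`, `𝒲_j` have the same dimension `dim j`. -/
structure Iterates (d n : ℕ) where
  dim : ℕ → ℕ
  V : ∀ j, Matrix (Fin n) (Fin (dim j)) ℂ
  W : ∀ j, Matrix (Fin n) (Fin (dim j)) ℂ
  μ : ℕ → Param d
  ω : ℕ → ℝ

namespace ParamSystem

variable {d n m p : ℕ} (S : ParamSystem d n m p)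

/-- The reduced system with the projection spaces `𝒱_j`, `𝒲_j`. -/
def reducedAt (it : Iterates d n) (j : ℕ) : StateSpace d (it.dim j) m p :=
  S.reduced (it.V j) (it.W j)

/-- What the two algorithms have in common in the iterations `1, …, k`, over the compact parameter
set `K`: the bases are orthonormal, `μ⁽ʲ⁺¹⁾` minimizes the norm of the system reduced by `𝒱_j`,
`𝒲_j`, and `ω⁽ʲ⁺¹⁾` maximizes `σ(μ⁽ʲ⁺¹⁾, ·)`. -/
def IsGreedy (K : Set (Param d)) (k : ℕ) (it : Iterates d n) : Prop :=
  (∀ j ≤ k, (it.V j)ᴴ * it.V j = 1 ∧ (it.W j)ᴴ * it.W j = 1) ∧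
  ∀ j < k,
    (it.μ (j + 1) ∈ K ∧
      ∀ ν ∈ K, (S.reducedAt it j).linfNorm (it.μ (j + 1)) ≤ (S.reducedAt it j).linfNorm ν) ∧
    S.full.IsMaxFreq (it.μ (j + 1)) (it.ω (j + 1))

/-- The first `k` iterations of the basic greedy algorithm. -/
def IsBasicRun (K : Set (Param d)) (k : ℕ) (it : Iterates d n) : Prop :=
  S.IsGreedy K k it ∧
  ∀ j < k,
    colSpace (it.V (j + 1)) =
      colSpace (it.V j) ⊔ S.full.expandV (it.μ (j + 1)) (it.ω (j + 1)) ∧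
    colSpace (it.W (j + 1)) =
      colSpace (it.W j) ⊔ S.full.expandW (it.μ (j + 1)) (it.ω (j + 1))

/-- `e_{aq} = (e_a + e_q) / √2` for `a ≠ q`, and `e_{aa} = e_a`. -/
def dirVec (a q : Fin d) : Param d :=
  if a = q then EuclideanSpace.single a 1
  else (1 / Real.sqrt 2) • (EuclideanSpace.single a 1 + EuclideanSpace.single q 1)

/-- The additional interpolation points `μ⁽ʲ⁺¹⁾ + h e_{aq}` of the extended algorithm in iteration
`j + 1 ≥ 2`, with `h = ‖μ⁽ʲ⁺¹⁾ - μ⁽ʲ⁾‖`. -/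
def extraPoint (it : Iterates d n) (j : ℕ) (a q : Fin d) : Param d :=
  it.μ (j + 1) + ‖it.μ (j + 1) - it.μ j‖ • dirVec a q

/-- The first `k` iterations of the extended greedy algorithm. -/
def IsExtendedRun (K : Set (Param d)) (k : ℕ) (it : Iterates d n) : Prop :=
  S.IsGreedy K k it ∧
  ∀ j < k, ∃ ω' : Fin d → Fin d → ℝ,
    (1 ≤ j → ∀ a q, a ≤ q →
      extraPoint it j a q ∈ S.Ω ∧ S.full.IsMaxFreq (extraPoint it j a q) (ω' a q)) ∧
    colSpace (it.V (j + 1)) =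
      colSpace (it.V j) ⊔ S.full.expandV (it.μ (j + 1)) (it.ω (j + 1)) ⊔
        ⨆ (_ : 1 ≤ j) (a : Fin d) (q : Fin d) (_ : a ≤ q),
          S.full.expandV (extraPoint it j a q) (ω' a q) ∧
    colSpace (it.W (j + 1)) =
      colSpace (it.W j) ⊔ S.full.expandW (it.μ (j + 1)) (it.ω (j + 1)) ⊔
        ⨆ (_ : 1 ≤ j) (a : Fin d) (q : Fin d) (_ : a ≤ q),
          S.full.expandW (extraPoint it j a q) (ω' a q)

end ParamSystem

/-- The coordinate directions of `(μ, ω) ∈ ℝ^d × ℝ`: `none` stands for `ω`, `some j` for `μ_j`. -/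
def coordDir {d : ℕ} : Option (Fin d) → Param d × ℝ
  | none => (0, 1)
  | some j => (EuclideanSpace.single j 1, 0)

/-- The partial derivative `F_χ` of a function of `(μ, ω)`. -/
def partialDeriv {d : ℕ} (χ : Option (Fin d)) (F : Param d × ℝ → ℝ) : Param d × ℝ → ℝ :=
  fun x => lineDeriv ℝ F x (coordDir χ)

end

/-!
The last iteration enlarges the projection spaces at `x₁ = (μ⁽ᵏ⁾, ω⁽ᵏ⁾)`, so `H^{V,W}(x₁) = H(x₁)`
by interpolation; and continuity of `σ` together with uniqueness of the maximizer of `σ(μ₀, ·)`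
brings `x₁` close to `x₀ = (μ₀, ω₀)`. The pairs `(V, W)` of orthonormal bases with
`|det D^{V,W}(x₀)| ≥ βʳ` form a compact set, so it suffices to find `U` and `η` near each pair `q`.
If `H^q(x₀) ≠ H(x₀)`, then near `q` interpolation at points close to `x₀` is impossible. If
`H^q(x₀) = H(x₀)`, then the largest singular value of `H^q(x₀)` is simple, hence, by the implicit
function theorem applied to `det(t - MᴴM)`, it is a smooth function of `(μ, ω)` and of the bases
near `(x₀, q)`.
-/

section MatrixNorm

open scoped Matrix.Norms.L2Operator

variable {a b : ℕ}

theorem singVal_nonneg (M : Matrix (Fin a) (Fin b) ℂ) (i : ℕ) : 0 ≤ singVal M i :=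
  LinearMap.singularValues_nonneg _ i

theorem singVal_antitone (M : Matrix (Fin a) (Fin b) ℂ) : Antitone (singVal M) :=
  LinearMap.singularValues_antitone _

theorem charpoly_adjoint_comp_self {𝕜 E F : Type*} [RCLike 𝕜]
    [NormedAddCommGroup E] [InnerProductSpace 𝕜 E] [FiniteDimensional 𝕜 E]
    [NormedAddCommGroup F] [InnerProductSpace 𝕜 F] [FiniteDimensional 𝕜 F]
    (T : E →ₗ[𝕜] F) {n : ℕ} (hn : Module.finrank 𝕜 E = n) :
    (LinearMap.adjoint T ∘ₗ T).charpoly =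
      ∏ i : Fin n, (Polynomial.X - Polynomial.C ((T.singularValues i ^ 2 : ℝ) : 𝕜)) := by
  simp_rw [T.sq_singularValues_fin hn]
  exact T.isSymmetric_adjoint_comp_self.charpoly_eq hn

theorem charpoly_conjTranspose_mul_self (M : Matrix (Fin a) (Fin b) ℂ) :
    (Mᴴ * M).charpoly =
      ∏ i : Fin b, (Polynomial.X - Polynomial.C ((singVal M i ^ 2 : ℝ) : ℂ)) := by
  have hgram : LinearMap.adjoint (toEuclideanLin M) ∘ₗ toEuclideanLin M =
      toEuclideanLin (Mᴴ * M) := by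
    rw [← toEuclideanLin_conjTranspose_eq_adjoint]
    ext x i
    simp [mulVec_mulVec]
  calc (Mᴴ * M).charpoly
      = (LinearMap.adjoint (toEuclideanLin M) ∘ₗ toEuclideanLin M).charpoly := by
        rw [hgram, toEuclideanLin_eq_toLin_orthonormal, charpoly_toLin]
    _ = _ := charpoly_adjoint_comp_self _ finrank_euclideanSpace_fin

theorem det_scalar_sub_conjTranspose_mul_self (M : Matrix (Fin a) (Fin b) ℂ) (t : ℂ) :
    (scalar (Fin b) t - Mᴴ * M).det = ∏ i : Fin b, (t - (singVal M i ^ 2 : ℝ)) := by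
  rw [← eval_charpoly, charpoly_conjTranspose_mul_self, Polynomial.eval_prod]
  simp

theorem mem_spectrum_conjTranspose_mul_self_iff {M : Matrix (Fin a) (Fin b) ℂ} {t : ℂ} :
    t ∈ spectrum ℂ (Mᴴ * M) ↔ ∃ i : Fin b, t = (singVal M i ^ 2 : ℝ) := by
  rw [mem_spectrum_iff_isRoot_charpoly, Polynomial.IsRoot.def, eval_charpoly,
    det_scalar_sub_conjTranspose_mul_self, Finset.prod_eq_zero_iff]
  simp only [Finset.mem_univ, true_and, sub_eq_zero]

theorem singVal_zero_eq_norm (M : Matrix (Fin a) (Fin b) ℂ) : singVal M 0 = ‖M‖ := by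
  rcases Nat.eq_zero_or_pos b with rfl | hb
  · rw [Subsingleton.elim M 0, norm_zero]
    exact LinearMap.singularValues_of_finrank_le _ (by simp)
  have : Nonempty (Fin b) := ⟨⟨0, hb⟩⟩
  refine le_antisymm (le_of_sq_le_sq ?_ (norm_nonneg M)) (le_of_sq_le_sq ?_ (singVal_nonneg M 0))
  all_goals rw [sq ‖M‖, ← l2_opNorm_conjTranspose_mul_self]
  · have hmem : ((singVal M 0 ^ 2 : ℝ) : ℂ) ∈ spectrum ℂ (Mᴴ * M) :=
      mem_spectrum_conjTranspose_mul_self_iff.2 ⟨⟨0, hb⟩, rfl⟩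
    simpa using spectrum.norm_le_norm_of_mem hmem
  · obtain ⟨t, ht, hnorm⟩ := spectrum.exists_nnnorm_eq_spectralRadius (Mᴴ * M)
    rw [(isHermitian_conjTranspose_mul_self M).isSelfAdjoint.spectralRadius_eq_nnnorm] at hnorm
    obtain ⟨i, rfl⟩ := mem_spectrum_conjTranspose_mul_self_iff.1 ht
    have hnorm' : ‖((singVal M i ^ 2 : ℝ) : ℂ)‖ = ‖Mᴴ * M‖ := by
      exact_mod_cast congrArg ENNReal.toReal hnorm
    rw [← hnorm', Complex.norm_real, Real.norm_of_nonneg (sq_nonneg _)]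
    exact pow_le_pow_left₀ (singVal_nonneg M i) (singVal_antitone M i.val.zero_le) 2

theorem prod_singVal_eq_norm_det {r : ℕ} (M : Matrix (Fin r) (Fin r) ℂ) :
    ∏ i : Fin r, singVal M i = ‖M.det‖ := by
  rw [← sq_eq_sq₀ (Finset.prod_nonneg fun _ _ => singVal_nonneg M _) (norm_nonneg _)]
  have h := congrArg norm (det_scalar_sub_conjTranspose_mul_self M 0)
  simpa [det_neg, det_mul, det_conjTranspose, norm_prod, ← sq, Finset.prod_pow] using h.symm

theorem sigmaMin_pow_le_norm_det {r : ℕ} (M : Matrix (Fin r) (Fin r) ℂ) :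
    sigmaMin M ^ r ≤ ‖M.det‖ := by
  rw [← prod_singVal_eq_norm_det]
  calc sigmaMin M ^ r = ∏ _i : Fin r, sigmaMin M := by simp
    _ ≤ ∏ i : Fin r, singVal M i := Finset.prod_le_prod (fun _ _ => singVal_nonneg M _)
        fun i _ => singVal_antitone M (Nat.le_sub_one_of_lt i.2)

section MatrixSmoothness

variable {X : Type*} [NormedAddCommGroup X] [NormedSpace ℝ X] {N : WithTop ℕ∞} {x : X}
  {α β γ : Type*} [Fintype α] [Fintype β] [Fintype γ] [DecidableEq β]
  [DecidableEq γ]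

theorem contDiffAt_matrix_mul {f : X → Matrix α β ℂ} {g : X → Matrix β γ ℂ}
    (hf : ContDiffAt ℝ N f x) (hg : ContDiffAt ℝ N g x) :
    ContDiffAt ℝ N (fun y => f y * g y) x := by
  have hmul : IsBoundedBilinearMap ℝ
      fun q : Matrix α β ℂ × Matrix β γ ℂ => q.1 * q.2 :=
    { add_left := Matrix.add_mul
      smul_left := fun c A B => Matrix.smul_mul c A B
      add_right := Matrix.mul_add
      smul_right := fun c A B => Matrix.mul_smul A c B
      bound := ⟨1, one_pos, fun A B => by simpa using l2_opNorm_mul A B⟩ }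
  exact hmul.contDiff.contDiffAt.comp x (hf.prodMk hg)

variable [DecidableEq α]

theorem contDiffAt_matrix_conjTranspose {f : X → Matrix α β ℂ} (hf : ContDiffAt ℝ N f x) :
    ContDiffAt ℝ N (fun y => (f y)ᴴ) x := by
  have hstar : IsBoundedLinearMap ℝ fun A : Matrix α β ℂ => Aᴴ :=
    { map_add := conjTranspose_add
      map_smul := fun c A => by simp
      bound := ⟨1, one_pos, fun A => by simp [l2_opNorm_conjTranspose]⟩ }
  exact hstar.contDiff.contDiffAt.comp x hf

theorem contDiffAt_matrix_inv {f : X → Matrix α α ℂ} (hf : ContDiffAt ℝ N f x)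
    (hdet : (f x).det ≠ 0) : ContDiffAt ℝ N (fun y => (f y)⁻¹) x := by
  have : CompleteSpace (Matrix α α ℂ) := FiniteDimensional.complete ℂ _
  obtain ⟨u, hu⟩ := (isUnit_iff_isUnit_det (f x)).2 hdet.isUnit
  simp only [nonsing_inv_eq_ringInverse]
  exact (hu ▸ contDiffAt_ringInverse ℝ u).comp x hf

theorem contDiffAt_matrix_det {f : X → Matrix α α ℂ} (hf : ContDiffAt ℝ N f x) :
    ContDiffAt ℝ N (fun y => (f y).det) x := by
  have hentry (i j : α) : ContDiffAt ℝ N (fun y => f y i j) x :=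
    ((entryLinearMap ℝ ℂ i j).toContinuousLinearMap).contDiff.contDiffAt.comp x hf
  simp only [det_apply']
  exact ContDiffAt.sum fun _ _ => contDiffAt_const.mul (contDiffAt_prod fun _ _ => hentry _ _)

end MatrixSmoothness

theorem contDiffAt_of_implicit_eq {𝕜 X : Type*} [RCLike 𝕜] [NormedAddCommGroup X]
    [NormedSpace 𝕜 X] [CompleteSpace X] {N : WithTop ℕ∞} (hN : N ≠ 0) {g : X × 𝕜 → 𝕜}
    {φ : X → 𝕜} {x₀ : X} {c : 𝕜} (hg : ContDiffAt 𝕜 N g (x₀, φ x₀))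
    (hderiv : HasDerivAt (fun t => g (x₀, t)) c (φ x₀)) (hc : c ≠ 0)
    (hφ : ContinuousAt φ x₀) (hroot : ∀ᶠ x in 𝓝 x₀, g (x, φ x) = 0) :
    ContDiffAt 𝕜 N φ x₀ := by
  have hpartial : (fderiv 𝕜 g (x₀, φ x₀) ∘L .inr 𝕜 X 𝕜) 1 = c :=
    ((hg.differentiableAt hN).hasFDerivAt.comp_hasDerivAt (φ x₀)
      ((hasDerivAt_const (φ x₀) x₀).prodMk (hasDerivAt_id (φ x₀)))).unique hderiv
  have hinv : (fderiv 𝕜 g (x₀, φ x₀) ∘L .inr 𝕜 X 𝕜).IsInvertible := by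
    refine ⟨ContinuousLinearEquiv.unitsEquivAut 𝕜 (Units.mk0 _ hc), ?_⟩
    ext
    simp [← hpartial]
  refine (hg.contDiffAt_implicitFunction hN hinv).congr_of_eventuallyEq ?_
  filter_upwards [hroot, (continuousAt_id.prodMk hφ).eventually
    (hg.eventually_apply_eq_iff_implicitFunction hN hinv)] with x hx himplicit
  exact (himplicit.1 (hx.trans hroot.self_of_nhds.symm)).symm

theorem hasDerivAt_prod_sub_root {𝕜 ι : Type*} [NontriviallyNormedField 𝕜] [Fintype ι]
    [DecidableEq ι] (t : ι → 𝕜) (i : ι) :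
    HasDerivAt (fun s => ∏ j, (s - t j)) (∏ j ∈ Finset.univ.erase i, (t i - t j)) (t i) := by
  have hcofactor : DifferentiableAt 𝕜 (fun s => ∏ j ∈ Finset.univ.erase i, (s - t j)) (t i) := by
    fun_prop
  simp_rw [← Finset.mul_prod_erase Finset.univ _ (Finset.mem_univ i)]
  simpa using ((hasDerivAt_id (t i)).sub_const (t i)).fun_mul hcofactor.hasDerivAt

section SimpleSingularValue

variable {N : WithTop ℕ∞}

theorem contDiff_re_det_scalar_sub_conjTranspose_mul_self :
    ContDiff ℝ N fun z : Matrix (Fin a) (Fin b) ℂ × ℝ =>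
      (scalar (Fin b) (z.2 : ℂ) - z.1ᴴ * z.1).det.re := by
  refine contDiff_iff_contDiffAt.2 fun z => Complex.reCLM.contDiff.contDiffAt.comp z
    (contDiffAt_matrix_det (ContDiffAt.sub ?_
      (contDiffAt_matrix_mul (contDiffAt_matrix_conjTranspose contDiffAt_fst) contDiffAt_fst)))
  simp only [← smul_one_eq_diagonal, scalar_apply]
  exact (Complex.ofRealCLM.contDiff.contDiffAt.comp z contDiffAt_snd).smul contDiffAt_const

theorem contDiffAt_singVal_zero (hN : N ≠ 0) {M₀ : Matrix (Fin a) (Fin b) ℂ}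
    (hsimple : singVal M₀ 1 < singVal M₀ 0) :
    ContDiffAt ℝ N (fun M : Matrix (Fin a) (Fin b) ℂ => singVal M 0) M₀ := by
  have hpos : 0 < singVal M₀ 0 := (singVal_nonneg M₀ 1).trans_lt hsimple
  have : NeZero b := ⟨fun hb => hpos.ne' (LinearMap.singularValues_of_finrank_le _ (by simp [hb]))⟩
  have hchar (M : Matrix (Fin a) (Fin b) ℂ) (t : ℝ) :
      (scalar (Fin b) (t : ℂ) - Mᴴ * M).det.re = ∏ i : Fin b, (t - singVal M i ^ 2) := by
    rw [det_scalar_sub_conjTranspose_mul_self]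
    exact_mod_cast Complex.ofReal_re _
  have hgap : ∏ i ∈ Finset.univ.erase (0 : Fin b), (singVal M₀ 0 ^ 2 - singVal M₀ i ^ 2) ≠ 0 :=
    Finset.prod_ne_zero_iff.2 fun i hi =>
      (sub_pos.2 (pow_lt_pow_left₀ ((singVal_antitone M₀ (Nat.one_le_iff_ne_zero.2
        (Fin.val_ne_zero_iff.2 (Finset.ne_of_mem_erase hi)))).trans_lt hsimple)
        (singVal_nonneg M₀ i) two_ne_zero)).ne'
  have hsq : ContDiffAt ℝ N (fun M : Matrix (Fin a) (Fin b) ℂ => singVal M 0 ^ 2) M₀ := by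
    refine contDiffAt_of_implicit_eq hN
      contDiff_re_det_scalar_sub_conjTranspose_mul_self.contDiffAt ?_ hgap ?_
      (Eventually.of_forall fun M => ?_)
    · simpa only [hchar, Fin.coe_ofNat_eq_mod, Nat.zero_mod] using
        hasDerivAt_prod_sub_root (fun i : Fin b => singVal M₀ i ^ 2) 0
    · simp only [singVal_zero_eq_norm]
      fun_prop
    · rw [hchar]
      exact Finset.prod_eq_zero (Finset.mem_univ 0) (sub_self _)
  simpa only [Real.sqrt_sq (singVal_nonneg _ 0)] using hsq.sqrt (pow_pos hpos 2).ne'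

end SimpleSingularValue

section PartialDerivatives

variable {d : ℕ}

theorem contDiffAt_lineDeriv {𝕜 X F : Type*} [NontriviallyNormedField 𝕜]
    [NormedAddCommGroup X] [NormedSpace 𝕜 X] [NormedAddCommGroup F] [NormedSpace 𝕜 F] {f : X → F}
    {x : X} {l : ℕ} (hf : ContDiffAt 𝕜 (l + 1 : ℕ) f x) (v : X) :
    ContDiffAt 𝕜 l (fun y => lineDeriv 𝕜 f y v) x := by
  push_cast at hf
  refine (hf.fderiv_right_succ.clm_apply (contDiffAt_const (c := v))).congr_of_eventuallyEq ?_
  filter_upwards [hf.eventually (by exact_mod_cast WithTop.coe_ne_top)] with y hy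
  exact (hy.differentiableAt (by simp)).lineDeriv_eq_fderiv

theorem contDiffAt_foldr_lineDeriv {𝕜 X F ι : Type*} [NontriviallyNormedField 𝕜]
    [NormedAddCommGroup X] [NormedSpace 𝕜 X] [NormedAddCommGroup F] [NormedSpace 𝕜 F] {f : X → F}
    {x : X} {k : ℕ} (v : ι → X) (L : List ι) (hf : ContDiffAt 𝕜 (k + L.length : ℕ) f x) :
    ContDiffAt 𝕜 k (L.foldr (fun i g y => lineDeriv 𝕜 g y (v i)) f) x := by
  induction L generalizing k with
  | nil => exact hf
  | cons i L ih => exact contDiffAt_lineDeriv (ih (by rwa [add_right_comm])) (v i)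

theorem foldr_partialDeriv_slice {Q : Type*} [NormedAddCommGroup Q] [NormedSpace ℝ Q]
    (Φ : (Param d × ℝ) × Q → ℝ) (q : Q) (L : List (Option (Fin d))) :
    L.foldr partialDeriv (fun x => Φ (x, q)) =
      fun x => L.foldr (fun χ g z => lineDeriv ℝ g z (coordDir χ, 0)) Φ (x, q) := by
  induction L with
  | nil => rfl
  | cons χ L ih =>
    funext x
    simp only [List.foldr_cons, ih, partialDeriv, lineDeriv, Prod.smul_mk, smul_zero,
      Prod.mk_add_mk, add_zero]

/-- `F` is `N` times continuously differentiable at `x`, and its partial derivatives of orders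
`0, …, N` at `x` are bounded by `U`. In the list `L` of differentiation variables the innermost
derivative comes last. -/
def HasPartialDerivBoundAt (N : ℕ) (U : ℝ) (F : Param d × ℝ → ℝ) (x : Param d × ℝ) : Prop :=
  ContDiffAt ℝ N F x ∧ ∀ L : List (Option (Fin d)), L.length ≤ N → |L.foldr partialDeriv F x| ≤ U

theorem eventually_hasPartialDerivBoundAt {Q : Type*} [NormedAddCommGroup Q] [NormedSpace ℝ Q]
    {N : ℕ} {Φ : (Param d × ℝ) × Q → ℝ} {x₀ : Param d × ℝ} {q₀ : Q}
    (hΦ : ContDiffAt ℝ N Φ (x₀, q₀)) :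
    ∀ᶠ w : ℝ × (Param d × ℝ) × Q in atTop ×ˢ 𝓝 (x₀, q₀),
      HasPartialDerivBoundAt N w.1 (fun y => Φ (y, w.2.2)) w.2.1 := by
  have hsmooth : ∀ᶠ w : ℝ × (Param d × ℝ) × Q in atTop ×ˢ 𝓝 (x₀, q₀), ContDiffAt ℝ N Φ w.2 :=
    tendsto_snd.eventually (hΦ.eventually (by simp))
  have hbound : ∀ L ∈ {L : List (Option (Fin d)) | L.length ≤ N},
      ∀ᶠ w : ℝ × (Param d × ℝ) × Q in atTop ×ˢ 𝓝 (x₀, q₀),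
        |L.foldr (fun χ g z => lineDeriv ℝ g z (coordDir χ, 0)) Φ w.2| ≤ w.1 := by
    intro L hL
    have hcont := (contDiffAt_foldr_lineDeriv (k := 0)
      (fun χ : Option (Fin d) => ((coordDir χ, 0) : (Param d × ℝ) × Q)) L
      (hΦ.of_le (by simpa using hL))).continuousAt.abs
    have hlarge := hcont.eventually_lt_const (lt_add_one _)
    filter_upwards [(eventually_ge_atTop _).prod_mk hlarge] with w hw
    exact hw.2.le.trans hw.1
  filter_upwards [hsmooth,
    (eventually_all_finite (List.finite_length_le (Option (Fin d)) N)).2 hbound] with w hw hwL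
  refine ⟨hw.comp w.2.1 (contDiffAt_id.prodMk contDiffAt_const), fun L hL => ?_⟩
  rw [foldr_partialDeriv_slice]
  exact hwL L hL

end PartialDerivatives

section Compactness

theorem eventually_forall_mem_of_isCompact {α Y : Type*} [TopologicalSpace Y] {l : Filter α}
    {K : Set Y} (hK : IsCompact K) {P : α → Y → Prop}
    (hP : ∀ y ∈ K, ∀ᶠ z : α × Y in l ×ˢ 𝓝 y, P z.1 z.2) : ∀ᶠ a in l, ∀ y ∈ K, P a y :=
  (Eventually.curry (hK.mem_prod_nhdsSet_of_forall hP)).mono fun _ ha => ha.self_of_nhdsSet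

theorem eventually_forall_notMem_lt {X Y Z : Type*} [TopologicalSpace X] [TopologicalSpace Y]
    [CompactSpace Y] [TopologicalSpace Z] [LinearOrder Z] [OrderClosedTopology Z] {f : X × Y → Z}
    {K : Set X} {O : Set Y} {x₀ : X} {y₀ : Y} (hO : IsOpen O)
    (hf : ∀ y, ContinuousWithinAt f (K ×ˢ Set.univ) (x₀, y))
    (hlt : ∀ y ∉ O, f (x₀, y) < f (x₀, y₀)) :
    ∀ᶠ x in 𝓝[K] x₀, ∀ y ∉ O, f (x, y) < f (x, y₀) := by
  simp only [ContinuousWithinAt, nhdsWithin_prod_eq, nhdsWithin_univ] at hf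
  refine eventually_forall_mem_of_isCompact hO.isClosed_compl.isCompact fun y hy => ?_
  exact (hf y).eventually_lt ((hf y₀).comp (tendsto_fst.prodMk tendsto_const_nhds)) (hlt y hy)

/-- The components of `w` are the bound, the point `x₁` at which `𝓗 (x₁, q) = H x₁`, and the point
at which the derivatives are bounded. -/
theorem eventually_forall_hasPartialDerivBoundAt_comp {d N : ℕ} {Q E : Type*}
    [NormedAddCommGroup Q] [NormedSpace ℝ Q] [NormedAddCommGroup E] [NormedSpace ℝ E]
    {F : E → ℝ} {H : Param d × ℝ → E} {𝓗 : (Param d × ℝ) × Q → E} {x₀ : Param d × ℝ} {𝒦 : Set Q}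
    (h𝒦 : IsCompact 𝒦) (hF : ContDiffAt ℝ N F (H x₀)) (hH : ContinuousAt H x₀)
    (h𝓗 : ∀ q ∈ 𝒦, ContDiffAt ℝ N 𝓗 (x₀, q)) :
    ∀ᶠ w : ℝ × (Param d × ℝ) × (Param d × ℝ) in atTop ×ˢ 𝓝 (x₀, x₀), ∀ q ∈ 𝒦,
      𝓗 (w.2.1, q) = H w.2.1 → HasPartialDerivBoundAt N w.1 (fun y => F (𝓗 (y, q))) w.2.2 := by
  simp only [nhds_prod_eq]
  refine eventually_forall_mem_of_isCompact h𝒦 fun q hq => ?_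
  set l := (atTop (α := ℝ) ×ˢ 𝓝 x₀ ×ˢ 𝓝 x₀) ×ˢ 𝓝 q
  have hfst : Tendsto (fun z : (ℝ × (Param d × ℝ) × (Param d × ℝ)) × Q => z.1.2.1) l (𝓝 x₀) :=
    tendsto_fst.comp (tendsto_snd.comp tendsto_fst)
  by_cases heq : 𝓗 (x₀, q) = H x₀
  · have hcomp : ContDiffAt ℝ N (fun z => F (𝓗 z)) (x₀, q) := (heq ▸ hF).comp (x₀, q) (h𝓗 q hq)
    have hproj : Tendsto (fun z : (ℝ × (Param d × ℝ) × (Param d × ℝ)) × Q =>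
        (z.1.1, z.1.2.2, z.2)) l (atTop ×ˢ 𝓝 (x₀, q)) := by
      rw [nhds_prod_eq]
      exact (tendsto_fst.comp tendsto_fst).prodMk
        ((tendsto_snd.comp (tendsto_snd.comp tendsto_fst)).prodMk tendsto_snd)
    exact (hproj.eventually (eventually_hasPartialDerivBoundAt hcomp)).mono fun z hz _ => hz
  · have h𝓗' : Tendsto (fun z : (ℝ × (Param d × ℝ) × (Param d × ℝ)) × Q => 𝓗 (z.1.2.1, z.2)) l
        (𝓝 (𝓗 (x₀, q))) :=
      (h𝓗 q hq).continuousAt.tendsto.comp (hfst.prodMk_nhds tendsto_snd)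
    exact ((h𝓗'.sub (hH.tendsto.comp hfst)).eventually_ne (sub_ne_zero.2 heq)).mono
      fun z hz hz' => absurd (sub_eq_zero.2 hz') hz

end Compactness

section TransferFunctions

theorem contDiffAt_matrix_mul_inv_mul {X : Type*} [NormedAddCommGroup X] [NormedSpace ℝ X]
    {N : WithTop ℕ∞} {x : X} {α β γ : Type*} [Fintype α] [Fintype β] [Fintype γ]
    [DecidableEq β] [DecidableEq γ] {C : X → Matrix α β ℂ} {D : X → Matrix β β ℂ}
    {B : X → Matrix β γ ℂ} (hC : ContDiffAt ℝ N C x) (hD : ContDiffAt ℝ N D x)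
    (hB : ContDiffAt ℝ N B x) (hdet : (D x).det ≠ 0) :
    ContDiffAt ℝ N (fun y => C y * (D y)⁻¹ * B y) x :=
  contDiffAt_matrix_mul (contDiffAt_matrix_mul hC (contDiffAt_matrix_inv hD hdet)) hB

namespace StateSpace

variable {d r m p : ℕ} (G : StateSpace d r m p)

theorem contDiff_Di {N : WithTop ℕ∞} (μ : Param d) : ContDiff ℝ N (G.Di μ) :=
  ((contDiff_const.mul Complex.ofRealCLM.contDiff).smul contDiff_const).sub contDiff_const

theorem continuousAt_sigma {μ : Param d} {ω : ℝ} (hdet : (G.Di μ ω).det ≠ 0) :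
    ContinuousAt (G.sigma μ) ω := by
  have hHi : ContDiffAt ℝ 0 (G.Hi μ) ω :=
    contDiffAt_matrix_mul_inv_mul contDiffAt_const (G.contDiff_Di μ).contDiffAt
      contDiffAt_const hdet
  exact hHi.continuousAt.norm.congr (Eventually.of_forall fun _ => (singVal_zero_eq_norm _).symm)

theorem sigmaExt_coe {μ : Param d} {ω : ℝ} (hdet : (G.Di μ ω).det ≠ 0) :
    G.sigmaExt μ (ω : OnePoint ℝ) = G.sigma μ ω :=
  ((G.continuousAt_sigma hdet).tendsto.mono_left nhdsWithin_le_nhds).limUnder_eq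

theorem eventually_isMaxFreq_abs_sub_lt {K : Set (Param d)} {μ₀ : Param d} {ω₀ : ℝ}
    (hsmooth : G.Smooth μ₀ ω₀)
    (hcont : ∀ ω : OnePoint ℝ, ContinuousWithinAt
      (fun x : Param d × OnePoint ℝ => G.sigmaExt x.1 x.2) (K ×ˢ Set.univ) (μ₀, ω))
    (hdet₀ : (G.Di μ₀ ω₀).det ≠ 0) (hdet : ∀ᶠ μ in 𝓝[K] μ₀, (G.Di μ ω₀).det ≠ 0)
    {ε : ℝ} (hε : 0 < ε) :
    ∀ᶠ μ in 𝓝[K] μ₀, ∀ ω, G.IsMaxFreq μ ω → 0 ≤ ω₀ * ω → |ω - ω₀| < ε := by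
  set O : Set (OnePoint ℝ) := (↑) '' (Metric.ball ω₀ ε ∪ Metric.ball (-ω₀) ε)
  have hO : IsOpen O :=
    OnePoint.isOpenEmbedding_coe.isOpenMap _ (Metric.isOpen_ball.union Metric.isOpen_ball)
  have hlt : ∀ ω ∉ O, G.sigmaExt μ₀ ω < G.sigmaExt μ₀ ω₀ := by
    intro ω hω
    rw [G.sigmaExt_coe hdet₀]
    refine hsmooth.1 ω (fun h => hω ?_) (fun h => hω ?_)
    · exact ⟨ω₀, Or.inl (Metric.mem_ball_self hε), h.symm⟩
    · exact ⟨-ω₀, Or.inr (Metric.mem_ball_self hε), h.symm⟩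
  filter_upwards [eventually_forall_notMem_lt (y₀ := (ω₀ : OnePoint ℝ)) hO hcont hlt, hdet]
    with μ hμ hμdet ω hω hsign
  have hmem : (ω : OnePoint ℝ) ∈ O := by
    by_contra hfar
    refine (hω.2 ω₀ hμdet).not_gt ?_
    rw [← G.sigmaExt_coe hω.1, ← G.sigmaExt_coe hμdet]
    exact hμ ω hfar
  rcases (OnePoint.coe_injective.mem_set_image).1 hmem with hnear | hnear
  · exact hnear
  · rw [Metric.mem_ball, Real.dist_eq, sub_neg_eq_add] at hnear
    have hle : |ω - ω₀| ≤ |ω + ω₀| := sq_le_sq.1 (by linarith)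
    exact hle.trans_lt hnear

end StateSpace

end TransferFunctions

theorem projected_mul_inv_mul_eq_of_inv_mul_eq {R α β γ δ : Type*} [CommRing R] [Fintype α]
    [DecidableEq α] [Fintype δ] [DecidableEq δ] {C : Matrix γ α R} {D : Matrix α α R}
    {B : Matrix α β R} {L : Matrix δ α R} {V : Matrix α δ R} {Y : Matrix δ β R}
    (hD : IsUnit D.det) (hproj : IsUnit (L * D * V).det) (hY : D⁻¹ * B = V * Y) :
    C * V * (L * D * V)⁻¹ * (L * B) = C * D⁻¹ * B := by
  have hLB : L * B = L * D * V * Y := by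
    rw [Matrix.mul_assoc _ V, ← hY, Matrix.mul_assoc, mul_nonsing_inv_cancel_left _ _ hD]
  rw [hLB, Matrix.mul_assoc, nonsing_inv_mul_cancel_left _ _ hproj, Matrix.mul_assoc, ← hY,
    Matrix.mul_assoc]

theorem projected_mul_inv_mul_eq_of_mul_inv_eq {R α β γ δ : Type*} [CommRing R] [Fintype α]
    [DecidableEq α] [Fintype δ] [DecidableEq δ] {C : Matrix γ α R} {D : Matrix α α R}
    {B : Matrix α β R} {L : Matrix δ α R} {V : Matrix α δ R} {Z : Matrix γ δ R}
    (hD : IsUnit D.det) (hproj : IsUnit (L * D * V).det) (hZ : C * D⁻¹ = Z * L) :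
    C * V * (L * D * V)⁻¹ * (L * B) = C * D⁻¹ * B := by
  have hCV : C * V = Z * (L * D * V) := by
    rw [Matrix.mul_assoc L, ← Matrix.mul_assoc, ← hZ, Matrix.mul_assoc,
      nonsing_inv_mul_cancel_left _ _ hD]
  rw [hCV, mul_nonsing_inv_cancel_right _ _ hproj, ← Matrix.mul_assoc, ← hZ]

theorem exists_eq_mul_of_colSpace_le {a b c : ℕ} {M : Matrix (Fin a) (Fin b) ℂ}
    {V : Matrix (Fin a) (Fin c) ℂ} (h : colSpace M ≤ colSpace V) :
    ∃ Y : Matrix (Fin c) (Fin b) ℂ, M = V * Y := by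
  have hcol (j : Fin b) : ∃ y, V *ᵥ y = M.col j :=
    h ⟨Pi.single j 1, by simp⟩
  choose y hy using hcol
  exact ⟨(of y)ᵀ, Matrix.ext_col fun j => (hy j).symm⟩

theorem le_of_conjTranspose_mul_self_eq_one {a b : ℕ} {V : Matrix (Fin a) (Fin b) ℂ}
    (hV : Vᴴ * V = 1) : b ≤ a := by
  calc b = (Vᴴ * V).rank := by rw [hV, rank_one, Fintype.card_fin]
    _ ≤ V.rank := rank_mul_le_right _ _
    _ ≤ a := V.rank_le_height

theorem norm_le_one_of_conjTranspose_mul_self_eq_one {a b : ℕ} {V : Matrix (Fin a) (Fin b) ℂ}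
    (hV : Vᴴ * V = 1) : ‖V‖ ≤ 1 := by
  have hsq : ‖V‖ * ‖V‖ ≤ 1 := by
    rw [← l2_opNorm_conjTranspose_mul_self, hV, ← diagonal_one, l2_opNorm_diagonal]
    exact (pi_norm_le_iff_of_nonneg zero_le_one).2 fun _ => norm_one.le
  exact (abs_norm V).symm.trans_le (abs_le_one_iff_mul_self_le_one.2 hsq)

theorem contDiffAt_sum_ofReal_smul {X F ι : Type*} [NormedAddCommGroup X] [NormedSpace ℝ X]
    [NormedAddCommGroup F] [NormedSpace ℂ F] [Fintype ι] {N : WithTop ℕ∞} {x : X}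
    {c : ι → X → ℝ} (hc : ∀ i, ContDiffAt ℝ N (c i) x) (v : ι → F) :
    ContDiffAt ℝ N (fun y => ∑ i, (c i y : ℂ) • v i) x :=
  ContDiffAt.sum fun i _ =>
    (Complex.ofRealCLM.contDiff.contDiffAt.comp x (hc i)).smul contDiffAt_const

namespace ParamSystem

variable {d n m p r : ℕ} (S : ParamSystem d n m p)

theorem contDiffAt_full_B {N : WithTop ℕ∞} {μ : Param d} (hμ : μ ∈ S.Ω) :
    ContDiffAt ℝ N S.full.B μ :=
  contDiffAt_sum_ofReal_smul (fun i => (S.analytic_h i μ hμ).contDiffAt) _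

theorem contDiffAt_full_C {N : WithTop ℕ∞} {μ : Param d} (hμ : μ ∈ S.Ω) :
    ContDiffAt ℝ N S.full.C μ :=
  contDiffAt_sum_ofReal_smul (fun i => (S.analytic_k i μ hμ).contDiffAt) _

theorem contDiffAt_full_Di {N : WithTop ℕ∞} {x : Param d × ℝ} (hx : x.1 ∈ S.Ω) :
    ContDiffAt ℝ N (fun y : Param d × ℝ => S.full.Di y.1 y.2) x := by
  have hE : ContDiffAt ℝ N S.full.E x.1 :=
    contDiffAt_sum_ofReal_smul (fun i => (S.analytic_f i x.1 hx).contDiffAt) _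
  have hA : ContDiffAt ℝ N S.full.A x.1 :=
    contDiffAt_sum_ofReal_smul (fun i => (S.analytic_g i x.1 hx).contDiffAt) _
  have hfreq : ContDiffAt ℝ N (fun y : Param d × ℝ => Complex.I * y.2) x :=
    contDiffAt_const.mul (Complex.ofRealCLM.contDiff.contDiffAt.comp x contDiffAt_snd)
  exact (hfreq.smul (hE.comp x contDiffAt_fst)).sub (hA.comp x contDiffAt_fst)

theorem eventually_det_full_Di_ne_zero {μ₀ : Param d} (hμ₀ : μ₀ ∈ S.Ω) {ω : ℝ}
    (hdet : (S.full.Di μ₀ ω).det ≠ 0) : ∀ᶠ μ in 𝓝 μ₀, (S.full.Di μ ω).det ≠ 0 := by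
  have hDi : ContDiffAt ℝ 0 (fun μ => S.full.Di μ ω) μ₀ :=
    (S.contDiffAt_full_Di (x := (μ₀, ω)) hμ₀).comp μ₀ (contDiffAt_id.prodMk contDiffAt_const)
  exact (contDiffAt_matrix_det hDi).continuousAt.eventually_ne hdet

theorem contDiffAt_full_Hi {N : WithTop ℕ∞} {x : Param d × ℝ} (hx : x.1 ∈ S.Ω)
    (hdet : (S.full.Di x.1 x.2).det ≠ 0) :
    ContDiffAt ℝ N (fun y : Param d × ℝ => S.full.Hi y.1 y.2) x :=
  contDiffAt_matrix_mul_inv_mul ((S.contDiffAt_full_C hx).comp x contDiffAt_fst)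
    (S.contDiffAt_full_Di hx) ((S.contDiffAt_full_B hx).comp x contDiffAt_fst) hdet

variable (V W : Matrix (Fin n) (Fin r) ℂ) (μ : Param d) (ω : ℝ)

theorem reduced_B : (S.reduced V W).B μ = Wᴴ * S.full.B μ := by
  simp [reduced, full, Matrix.mul_sum]

theorem reduced_C : (S.reduced V W).C μ = S.full.C μ * V := by
  simp [reduced, full, Matrix.sum_mul]

theorem reduced_Di : (S.reduced V W).Di μ ω = Wᴴ * S.full.Di μ ω * V := by
  simp [StateSpace.Di, StateSpace.D, reduced, full, Matrix.mul_sub, Matrix.sub_mul,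
    Matrix.mul_sum, Matrix.sum_mul]

theorem reduced_Hi : (S.reduced V W).Hi μ ω =
    S.full.C μ * V * (Wᴴ * S.full.Di μ ω * V)⁻¹ * (Wᴴ * S.full.B μ) := by
  rw [← reduced_Di, ← reduced_B, ← reduced_C]
  rfl

variable {V W μ ω}

theorem reduced_Hi_eq (hfull : (S.full.Di μ ω).det ≠ 0)
    (hred : ((S.reduced V W).Di μ ω).det ≠ 0)
    (hV : S.full.expandV μ ω ≤ colSpace V) (hW : S.full.expandW μ ω ≤ colSpace W) :
    (S.reduced V W).Hi μ ω = S.full.Hi μ ω := by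
  rw [reduced_Di] at hred
  rw [reduced_Hi]
  rcases le_total m p with hmp | hpm
  · rw [StateSpace.expandV, if_pos hmp] at hV
    obtain ⟨Y, hY⟩ := exists_eq_mul_of_colSpace_le hV
    exact projected_mul_inv_mul_eq_of_inv_mul_eq hfull.isUnit hred.isUnit hY
  · rw [StateSpace.expandW, if_pos hpm] at hW
    obtain ⟨Z, hZ⟩ := exists_eq_mul_of_colSpace_le hW
    refine projected_mul_inv_mul_eq_of_mul_inv_eq (Z := Zᴴ) hfull.isUnit hred.isUnit ?_
    simpa [conjTranspose_mul] using congrArg conjTranspose hZ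

theorem contDiffAt_reduced_Di {N : WithTop ℕ∞} {x : Param d × ℝ} (hx : x.1 ∈ S.Ω)
    (q : Matrix (Fin n) (Fin r) ℂ × Matrix (Fin n) (Fin r) ℂ) :
    ContDiffAt ℝ N (fun z : (Param d × ℝ) × Matrix (Fin n) (Fin r) ℂ × Matrix (Fin n) (Fin r) ℂ =>
      (S.reduced z.2.1 z.2.2).Di z.1.1 z.1.2) (x, q) := by
  simp only [reduced_Di]
  exact contDiffAt_matrix_mul (contDiffAt_matrix_mul
    (contDiffAt_matrix_conjTranspose contDiffAt_snd.snd)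
    ((S.contDiffAt_full_Di hx).comp (x, q) contDiffAt_fst)) contDiffAt_snd.fst

theorem contDiffAt_reduced_Hi {N : WithTop ℕ∞} {x : Param d × ℝ} (hx : x.1 ∈ S.Ω)
    {q : Matrix (Fin n) (Fin r) ℂ × Matrix (Fin n) (Fin r) ℂ}
    (hdet : ((S.reduced q.1 q.2).Di x.1 x.2).det ≠ 0) :
    ContDiffAt ℝ N (fun z : (Param d × ℝ) × Matrix (Fin n) (Fin r) ℂ × Matrix (Fin n) (Fin r) ℂ =>
      (S.reduced z.2.1 z.2.2).Hi z.1.1 z.1.2) (x, q) := by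
  have hB : ContDiffAt ℝ N (fun z : (Param d × ℝ) × Matrix (Fin n) (Fin r) ℂ ×
      Matrix (Fin n) (Fin r) ℂ => (S.reduced z.2.1 z.2.2).B z.1.1) (x, q) := by
    simp only [reduced_B]
    exact contDiffAt_matrix_mul (contDiffAt_matrix_conjTranspose contDiffAt_snd.snd)
      ((S.contDiffAt_full_B hx).comp (x, q) contDiffAt_fst.fst)
  have hC : ContDiffAt ℝ N (fun z : (Param d × ℝ) × Matrix (Fin n) (Fin r) ℂ ×
      Matrix (Fin n) (Fin r) ℂ => (S.reduced z.2.1 z.2.2).C z.1.1) (x, q) := by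
    simp only [reduced_C]
    exact contDiffAt_matrix_mul ((S.contDiffAt_full_C hx).comp (x, q) contDiffAt_fst.fst)
      contDiffAt_snd.fst
  exact contDiffAt_matrix_mul_inv_mul hC (S.contDiffAt_reduced_Di hx q) hB hdet

/-- The pairs `(V, W)` of orthonormal bases for which `|det D^{V,W}|` is at least `c` at the point
`x`. The bound is on the determinant rather than on the smallest singular value, so that it is
visibly a closed condition on `(V, W)`. -/
def nondegenerateBases (r : ℕ) (x : Param d × ℝ) (c : ℝ) :
    Set (Matrix (Fin n) (Fin r) ℂ × Matrix (Fin n) (Fin r) ℂ) :=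
  {q | q.1ᴴ * q.1 = 1 ∧ q.2ᴴ * q.2 = 1 ∧ c ≤ ‖((S.reduced q.1 q.2).Di x.1 x.2).det‖}

theorem isCompact_nondegenerateBases (x : Param d × ℝ) (c : ℝ) :
    IsCompact (S.nondegenerateBases r x c) := by
  have : ProperSpace (Matrix (Fin n) (Fin r) ℂ) := FiniteDimensional.proper ℂ _
  refine Metric.isCompact_of_isClosed_isBounded ?_ ?_
  · have hgram : Continuous fun V : Matrix (Fin n) (Fin r) ℂ => Vᴴ * V := by fun_prop
    have hdet : Continuous fun q : Matrix (Fin n) (Fin r) ℂ × Matrix (Fin n) (Fin r) ℂ =>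
        ‖((S.reduced q.1 q.2).Di x.1 x.2).det‖ := by
      simp only [reduced_Di]
      fun_prop
    exact (isClosed_eq (hgram.comp continuous_fst) continuous_const).inter
      ((isClosed_eq (hgram.comp continuous_snd) continuous_const).inter
        (isClosed_le continuous_const hdet))
  · refine isBounded_iff_forall_norm_le.2 ⟨1, fun q hq => norm_prod_le_iff.2 ⟨?_, ?_⟩⟩
    · exact norm_le_one_of_conjTranspose_mul_self_eq_one hq.1
    · exact norm_le_one_of_conjTranspose_mul_self_eq_one hq.2.1

theorem eventually_det_reduced_Di_ne_zero {x₀ : Param d × ℝ} (hx₀ : x₀.1 ∈ S.Ω) {c : ℝ}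
    (hc : 0 < c) : ∀ᶠ x in 𝓝 x₀, ∀ q ∈ S.nondegenerateBases r x₀ c,
      ((S.reduced q.1 q.2).Di x.1 x.2).det ≠ 0 := by
  refine eventually_forall_mem_of_isCompact (S.isCompact_nondegenerateBases x₀ c) fun q hq => ?_
  rw [← nhds_prod_eq]
  exact (contDiffAt_matrix_det (N := 0) (S.contDiffAt_reduced_Di hx₀ q)).continuousAt.eventually_ne
    (norm_pos_iff.1 (hc.trans_le hq.2.2))

theorem eventually_hasPartialDerivBoundAt_reduced_sigma {x₀ : Param d × ℝ} (hx₀ : x₀.1 ∈ S.Ω)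
    (hdet₀ : (S.full.Di x₀.1 x₀.2).det ≠ 0)
    (hsimple : singVal (S.full.Hi x₀.1 x₀.2) 1 < singVal (S.full.Hi x₀.1 x₀.2) 0)
    {c : ℝ} (hc : 0 < c) (N : ℕ) :
    ∀ᶠ w : ℝ × (Param d × ℝ) × (Param d × ℝ) in atTop ×ˢ 𝓝 (x₀, x₀),
      ∀ q ∈ S.nondegenerateBases r x₀ c, (S.full.Di w.2.1.1 w.2.1.2).det ≠ 0 →
        S.full.expandV w.2.1.1 w.2.1.2 ≤ colSpace q.1 →
        S.full.expandW w.2.1.1 w.2.1.2 ≤ colSpace q.2 →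
        HasPartialDerivBoundAt N w.1 (fun y => (S.reduced q.1 q.2).sigma y.1 y.2) w.2.2 := by
  have hbound := eventually_forall_hasPartialDerivBoundAt_comp (N := N)
    (S.isCompact_nondegenerateBases (r := r) x₀ c)
    ((contDiffAt_singVal_zero WithTop.top_ne_zero hsimple).of_le le_top)
    (S.contDiffAt_full_Hi (N := 0) hx₀ hdet₀).continuousAt
    (fun q hq => S.contDiffAt_reduced_Hi hx₀ (norm_pos_iff.1 (hc.trans_le hq.2.2)))
  have hdet := ((S.eventually_det_reduced_Di_ne_zero (r := r) hx₀ hc).prod_inl_nhds x₀).prod_inr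
    (atTop : Filter ℝ)
  filter_upwards [hbound, hdet] with w hw hwdet q hq hfull hV hW
  exact hw q hq (S.reduced_Hi_eq hfull (hwdet q hq) hV hW)

/-- The outcome of one iteration of either greedy algorithm at the parameter `μ` and the frequency
`ω`: orthonormal bases `V`, `W` of projection spaces that have been enlarged at `(μ, ω)`. -/
structure IsGreedyReduction (V W : Matrix (Fin n) (Fin r) ℂ) (μ : Param d) (ω : ℝ) : Prop where
  conjTranspose_mul_self_V : Vᴴ * V = 1
  conjTranspose_mul_self_W : Wᴴ * W = 1
  isMaxFreq : S.full.IsMaxFreq μ ω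
  expandV_le : S.full.expandV μ ω ≤ colSpace V
  expandW_le : S.full.expandW μ ω ≤ colSpace W

theorem isGreedyReduction_of_run {K : Set (Param d)} {k : ℕ} (hk : 1 ≤ k) {it : Iterates d n}
    (hrun : S.IsBasicRun K k it ∨ S.IsExtendedRun K k it) :
    it.μ k ∈ K ∧ S.IsGreedyReduction (it.V k) (it.W k) (it.μ k) (it.ω k) := by
  obtain ⟨j, rfl⟩ := Nat.exists_eq_add_of_le' hk
  have hgreedy : S.IsGreedy K (j + 1) it := hrun.elim (·.1) (·.1)
  obtain ⟨horthV, horthW⟩ := hgreedy.1 (j + 1) le_rfl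
  obtain ⟨⟨hμ, -⟩, hω⟩ := hgreedy.2 j j.lt_succ_self
  rcases hrun with ⟨-, hexpand⟩ | ⟨-, hexpand⟩
  · obtain ⟨hV, hW⟩ := hexpand j j.lt_succ_self
    exact ⟨hμ, horthV, horthW, hω, le_sup_right.trans_eq hV.symm, le_sup_right.trans_eq hW.symm⟩
  · obtain ⟨_, -, hV, hW⟩ := hexpand j j.lt_succ_self
    exact ⟨hμ, horthV, horthW, hω, (le_sup_right.trans le_sup_left).trans_eq hV.symm,
      (le_sup_right.trans le_sup_left).trans_eq hW.symm⟩

theorem IsGreedyReduction.mem_nondegenerateBases {S : ParamSystem d n m p}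
    {V W : Matrix (Fin n) (Fin r) ℂ} {μ μ₀ : Param d} {ω ω₀ β : ℝ}
    (h : S.IsGreedyReduction V W μ ω) (hβ : 0 ≤ β)
    (hσ : β ≤ sigmaMin ((S.reduced V W).Di μ₀ ω₀)) :
    (V, W) ∈ S.nondegenerateBases r (μ₀, ω₀) (β ^ r) :=
  ⟨h.conjTranspose_mul_self_V, h.conjTranspose_mul_self_W,
    (pow_le_pow_left₀ hβ hσ r).trans (sigmaMin_pow_le_norm_det _)⟩

theorem exists_hasPartialDerivBoundAt_of_isGreedyReduction {x₀ : Param d × ℝ} (hx₀ : x₀.1 ∈ S.Ω)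
    (hdet₀ : (S.full.Di x₀.1 x₀.2).det ≠ 0)
    (hsimple : singVal (S.full.Hi x₀.1 x₀.2) 1 < singVal (S.full.Hi x₀.1 x₀.2) 0)
    {β : ℝ} (hβ : 0 < β) (N : ℕ) :
    ∃ U η : ℝ, 0 < η ∧ ∀ x₁ ∈ Metric.closedBall x₀ η, ∀ x ∈ Metric.closedBall x₀ η,
      x.1 ∈ S.Ω ∧ ∀ (r : ℕ) (V W : Matrix (Fin n) (Fin r) ℂ), S.IsGreedyReduction V W x₁.1 x₁.2 →
        β ≤ sigmaMin ((S.reduced V W).Di x₀.1 x₀.2) →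
        ((S.reduced V W).Di x.1 x.2).det ≠ 0 ∧
        HasPartialDerivBoundAt N U (fun y => (S.reduced V W).sigma y.1 y.2) x := by
  have hbound := (eventually_all (ι := Fin (n + 1))).2 fun r =>
    S.eventually_hasPartialDerivBoundAt_reduced_sigma (r := r) hx₀ hdet₀ hsimple
      (pow_pos hβ (r : ℕ)) N
  have hdet := (eventually_all (ι := Fin (n + 1))).2 fun r =>
    S.eventually_det_reduced_Di_ne_zero (r := r) hx₀ (pow_pos hβ (r : ℕ))
  have hΩ : ∀ᶠ x in 𝓝 x₀, x.1 ∈ S.Ω := continuousAt_fst.eventually (S.isOpen.mem_nhds hx₀)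
  obtain ⟨U, hU⟩ := hbound.curry.exists
  rw [nhds_prod_eq] at hU
  obtain ⟨η, hη, hball⟩ := Metric.nhds_basis_closedBall.prod_self.eventually_iff.1
    (hU.and ((hdet.and hΩ).prod_inr _))
  refine ⟨U, η, hη, fun x₁ hx₁ x hx => ?_⟩
  obtain ⟨hbd, hdetx, hxΩ⟩ := hball (x := (x₁, x)) ⟨hx₁, hx⟩
  refine ⟨hxΩ, fun r V W hred hσ => ?_⟩
  have hr : r < n + 1 :=
    Nat.lt_succ_of_le (le_of_conjTranspose_mul_self_eq_one hred.conjTranspose_mul_self_V)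
  have hq := hred.mem_nondegenerateBases hβ.le hσ
  exact ⟨hdetx ⟨r, hr⟩ (V, W) hq,
    hbd ⟨r, hr⟩ (V, W) hq hred.isMaxFreq.1 hred.expandV_le hred.expandW_le⟩

end ParamSystem

end MatrixNorm

theorem lemma3p3_general {d n m p : ℕ} (S : ParamSystem d n m p) (K : Set (Param d))
    {μ₀ : Param d} (hμ₀ : μ₀ ∈ S.Ω) {ω₀ : ℝ} (hsmooth : S.full.Smooth μ₀ ω₀)
    (hcont : ∀ ω : OnePoint ℝ, ContinuousWithinAt
      (fun x : Param d × OnePoint ℝ => S.full.sigmaExt x.1 x.2) (K ×ˢ Set.univ) (μ₀, ω))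
    (hdet₀ : (S.full.Di μ₀ ω₀).det ≠ 0) {β : ℝ} (hβ : 0 < β) (N : ℕ) :
    ∃ U η : ℝ, 0 < η ∧ Metric.closedBall μ₀ η ⊆ S.Ω ∧ ∀ᶠ μ₁ in 𝓝[K] μ₀,
      ∀ (r : ℕ) (V W : Matrix (Fin n) (Fin r) ℂ) (ω₁ : ℝ), S.IsGreedyReduction V W μ₁ ω₁ →
        0 ≤ ω₀ * ω₁ → β ≤ sigmaMin ((S.reduced V W).Di μ₀ ω₀) →
        ∀ μ ∈ Metric.closedBall μ₀ η, ∀ ω ∈ Metric.closedBall ω₀ η,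
          ((S.reduced V W).Di μ ω).det ≠ 0 ∧
          HasPartialDerivBoundAt N U (fun x => (S.reduced V W).sigma x.1 x.2) (μ, ω) := by
  obtain ⟨U, η, hη, hbound⟩ := S.exists_hasPartialDerivBoundAt_of_isGreedyReduction
    (x₀ := (μ₀, ω₀)) hμ₀ hdet₀ hsmooth.2.2 hβ N
  simp only [← closedBall_prod_same] at hbound
  have hμ₀η := Metric.mem_closedBall_self (x := μ₀) hη.le
  have hω₀η := Metric.mem_closedBall_self (x := ω₀) hη.le
  refine ⟨U, η, hη, fun μ hμ => (hbound (μ₀, ω₀) ⟨hμ₀η, hω₀η⟩ (μ, ω₀) ⟨hμ, hω₀η⟩).1, ?_⟩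
  filter_upwards [S.full.eventually_isMaxFreq_abs_sub_lt hsmooth hcont hdet₀
      (nhdsWithin_le_nhds (S.eventually_det_full_Di_ne_zero hμ₀ hdet₀)) hη,
    nhdsWithin_le_nhds (Metric.closedBall_mem_nhds μ₀ hη)]
    with μ₁ hfreq hμ₁ r V W ω₁ hred hsign hσ μ hμ ω hω
  have hω₁ : ω₁ ∈ Metric.closedBall ω₀ η := (hfreq ω₁ hred.isMaxFreq hsign).le
  exact (hbound (μ₁, ω₁) ⟨hμ₁, hω₁⟩ (μ, ω) ⟨hμ, hω⟩).2 r V W hred hσ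

theorem lemma3p3 {d n m p : ℕ} (S : ParamSystem d n m p)
    (K : Set (Param d)) (hK : IsCompact K) (hKΩ : K ⊆ S.Ω)
    (hH : ∀ μ ∈ K, S.full.MemHinf μ)
    (μ₀ : Param d) (hμ₀ : μ₀ ∈ K) (hmin : IsLocalMinOn S.full.hinfNorm K μ₀)
    (ω₀ : ℝ) (hsmooth : S.full.Smooth μ₀ ω₀)
    (hcont : ∀ ω : OnePoint ℝ, ContinuousWithinAt
      (fun x : Param d × OnePoint ℝ => S.full.sigmaExt x.1 x.2) (K ×ˢ Set.univ) (μ₀, ω))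
    (β : ℝ) (hβ : 0 < β) (hD : β ≤ sigmaMin (S.full.Di μ₀ ω₀))
    (k : ℕ) (hk : 1 ≤ k) :
    ∃ U ημ ηω : ℝ, 0 < ημ ∧ 0 < ηω ∧ Metric.closedBall μ₀ ημ ⊆ S.Ω ∧
      ∀ R : Set (Iterates d n),
        (∀ it ∈ R, (S.IsBasicRun K k it ∨ S.IsExtendedRun K k it) ∧ 0 ≤ ω₀ * it.ω k) →
        (∀ ε > 0, ∃ δ > 0, ∀ it ∈ R, ‖it.μ 1 - μ₀‖ < δ → ‖it.μ k - μ₀‖ < ε) →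
        ∃ δ > 0, ∀ it ∈ R, ‖it.μ 1 - μ₀‖ < δ →
          β ≤ sigmaMin ((S.reducedAt it k).Di μ₀ ω₀) →
          ∀ μ ∈ Metric.closedBall μ₀ ημ, ∀ ω ∈ Metric.closedBall ω₀ ηω,
            ((S.reducedAt it k).Di μ ω).det ≠ 0 ∧
            ContDiffAt ℝ 3
              (fun x : Param d × ℝ => (S.reducedAt it k).sigma x.1 x.2) (μ, ω) ∧
            ∀ χ₁ χ₂ χ₃ : Option (Fin d),
              |partialDeriv χ₁
                (fun x => (S.reducedAt it k).sigma x.1 x.2) (μ, ω)| ≤ U ∧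
              |partialDeriv χ₂ (partialDeriv χ₁
                (fun x => (S.reducedAt it k).sigma x.1 x.2)) (μ, ω)| ≤ U ∧
              |partialDeriv χ₃ (partialDeriv χ₂ (partialDeriv χ₁
                (fun x => (S.reducedAt it k).sigma x.1 x.2))) (μ, ω)| ≤ U := by
  have hdet₀ : (S.full.Di μ₀ ω₀).det ≠ 0 := norm_pos_iff.1
    ((pow_pos (hβ.trans_le hD) n).trans_le (sigmaMin_pow_le_norm_det _))
  obtain ⟨U, η, hη, hΩ, hnear⟩ := lemma3p3_general S K (hKΩ hμ₀) hsmooth hcont hdet₀ hβ 3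
  obtain ⟨ε, hε, hball⟩ := Metric.nhdsWithin_basis_ball.eventually_iff.1 hnear
  refine ⟨U, η, η, hη, hη, hΩ, fun R hR hconv => ?_⟩
  obtain ⟨δ, hδ, hδR⟩ := hconv ε hε
  refine ⟨δ, hδ, fun it hit hit₁ hσ μ hμ ω hω => ?_⟩
  obtain ⟨hμK, hred⟩ := S.isGreedyReduction_of_run hk (hR it hit).1
  obtain ⟨hdet, hsm, hbound⟩ := hball ⟨mem_ball_iff_norm.2 (hδR it hit hit₁), hμK⟩ _ _ _ _ hred
    (hR it hit).2 hσ μ hμ ω hω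
  exact ⟨hdet, hsm, fun χ₁ χ₂ χ₃ => ⟨hbound [χ₁] (by simp), hbound [χ₂, χ₁] (by simp),
    hbound [χ₃, χ₂, χ₁] (by simp)⟩⟩
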